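/- For a set $X\subseteq\mathbb C$ let $\mathbb C^X$ carry the product topology and let $F_X=\{u\in\mathbb C^X : u(x)\neq u(y)\text{ for all } x\neq y \text{ in } X\}$ carry the subspace topology. An $X$-braid is a continuous map $f:[0,1]\to F_X$ such that $f(0)=\mathrm{id}_X$ (that is, $f(0)(x)=x$ for all $x\in X$) and $f(1)$ is a permutation of $X$. For $Y\subseteq X$ and a path $f$ in $F_X$, the restriction $f|_Y$ is the path in $F_Y$ given by $f|_Y(t)(y)=f(t)(y)$ for $t\in[0,1]$, $y\in Y$. For paths $f,g$ in the same space, write $f\sim g$ if $f$ and $g$ are homotopic relative to $\{0,1\}$. Let $\omega=\{0,1,2,\dots\}\subset\mathbb C$, and identify each $n\in\omega$ with the set $\{0,\dots,n-1\}$. Theorem 2.4. Let $f,g$ be $\omega$-braids. Then $f\sim g$ in $F_\omega$ if and only if $f|_n\sim g|_n$ in $F_n$ for every $n\in\omega$. -/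

import Mathlib

namespace InfBraid

/-- The union of the diagonals `{u | u x = u y}`, `x ≠ y`, in the product space `ℂ^X`. -/
def diagonal (X : Set ℂ) : Set (X → ℂ) :=
  ⋃ (x : X) (y : X) (_ : x ≠ y), {u | u x = u y}

/-- The configuration space `F_X = ℂ^X \ Δ_X`, a subspace of the product space `ℂ^X`. -/
abbrev Conf (X : Set ℂ) : Type := ↥((diagonal X)ᶜ)

theorem mem_compl_diagonal_iff {X : Set ℂ} {u : X → ℂ} :
    u ∈ (diagonal X)ᶜ ↔ Function.Injective u := by
  simp only [diagonal, Set.mem_compl_iff, Set.mem_iUnion, Set.mem_ofPred_eq, not_exists]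
  exact ⟨fun h x y hxy => by_contra fun hne => h x y hne hxy, fun h x y hne hxy => hne (h hxy)⟩

/-- An `X`-braid: a path in `F_X` from the inclusion `id_X` to a permutation of `X`. -/
structure IsBraid {X : Set ℂ} (f : C(unitInterval, Conf X)) : Prop where
  source : ∀ x : X, (f 0).1 x = (x : ℂ)
  target : ∃ σ : Equiv.Perm X, ∀ x : X, (f 1).1 x = (σ x : ℂ)

/-- Forgetting coordinates, `F_X → F_Y` for `Y ⊆ X`. -/
noncomputable def Conf.restrict {X Y : Set ℂ} (h : Y ⊆ X) : C(Conf X, Conf Y) where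
  toFun u := ⟨fun y => u.1 (Set.inclusion h y), mem_compl_diagonal_iff.2
    ((mem_compl_diagonal_iff.1 u.2).comp (Set.inclusion_injective h))⟩
  continuous_toFun := by
    refine Continuous.subtype_mk (continuous_pi fun y => ?_) _
    exact (continuous_apply (A := fun _ : X => ℂ) (Set.inclusion h y)).comp continuous_subtype_val

/-- The restriction `f|_Y` of a path `f` in `F_X` to `Y ⊆ X`. -/
noncomputable def restrictPath {X Y : Set ℂ} (h : Y ⊆ X) (f : C(unitInterval, Conf X)) :
    C(unitInterval, Conf Y) :=
  (Conf.restrict h).comp f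

/-- `f ∼ g`: the paths `f` and `g` are homotopic relative to `{0, 1}`. -/
def PathHomotopic {Z : Type*} [TopologicalSpace Z] (f g : C(unitInterval, Z)) : Prop :=
  ContinuousMap.HomotopicRel f g {0, 1}

/-- The set `ω = {0, 1, 2, …}`, as a subset of `ℂ`. -/
def omega : Set ℂ := Set.range fun k : ℕ => (k : ℂ)

/-- The set `n = {0, …, n - 1}`, as a subset of `ℂ`. -/
def initial (n : ℕ) : Set ℂ := (fun k : ℕ => (k : ℂ)) '' Set.Iio n

theorem initial_subset_omega (n : ℕ) : initial n ⊆ omega :=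
  Set.image_subset_range _ _

end InfBraid

open Set Filter Topology

/-! Contracting the loop that runs along `f` and back along `g` reduces the theorem to this: a loop
of infinitely many strands is null-homotopic if each finite set of initial strands is.
Null-homotopies for different `n` need not be compatible, so they are built strand by strand, each
prolonging the last. The inductive step is `IsNullHomotopy.exists_extension`. Given `H` on `n`
strands and any `P` on `n + 1`, the concatenation of `P`, its reverse and `H` deforms to `H` on `n`
strands, relative to the boundary. Over this concatenation a last strand exists: follow `P` until
everything is trivial, then take `farPoint`, a section of the projection forgetting the last point.
`exists_transport` carries that strand along the deformation and fixes it on the boundary, where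
nothing moves. The limit is continuous because the product topology only tests single coordinates.
-/

namespace InfBraid

/-! ### Regular homotopy lifting. -/

/-- The map `z ↦ z + ∑ᵢ χ(z - uᵢ) (u'ᵢ - uᵢ)`, where `χ` is the cone of height one over the disc of
radius `r`. It moves each `uᵢ` to `u'ᵢ` if the `uᵢ` are `r`-separated. -/
noncomputable def push (r : ℝ) (n : ℕ) (u u' : ℕ → ℂ) (z : ℂ) : ℂ :=
  z + ∑ i ∈ Finset.range n, ((max 0 (1 - ‖z - u i‖ / r) : ℝ) : ℂ) * (u' i - u i)

theorem push_apply_point {r : ℝ} (hr : 0 < r) {n : ℕ} {u u' : ℕ → ℂ}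
    (hu : ∀ i < n, ∀ j < n, i ≠ j → r ≤ ‖u i - u j‖) {j : ℕ} (hj : j < n) :
    push r n u u' (u j) = u' j := by
  have h : ∑ i ∈ Finset.range n, ((max 0 (1 - ‖u j - u i‖ / r) : ℝ) : ℂ) * (u' i - u i)
      = u' j - u j := by
    rw [Finset.sum_eq_single_of_mem j (Finset.mem_range.2 hj)]
    · simp
    · intro i hi hij
      have h1 : 1 ≤ ‖u j - u i‖ / r := by
        rw [le_div_iff₀ hr, one_mul]
        exact hu j hj i (Finset.mem_range.1 hi) hij.symm
      rw [max_eq_left (by linarith)]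
      simp
  rw [push, h]
  ring

theorem push_of_eq {r : ℝ} {n : ℕ} {u u' : ℕ → ℂ} (h : ∀ i < n, u' i = u i) (z : ℂ) :
    push r n u u' z = z := by
  rw [push, Finset.sum_eq_zero, add_zero]
  intro i hi
  rw [h i (Finset.mem_range.1 hi), sub_self, mul_zero]

/-- Each cone has slope at most `1 / r`, so the total displacement is Lipschitz with constant `n * ε
/ r < 1` and cannot cancel `z - z'`. -/
theorem push_injective {r ε : ℝ} (hr : 0 < r) {n : ℕ} (hε : n * ε < r) {u u' : ℕ → ℂ}
    (hu : ∀ i < n, ‖u' i - u i‖ ≤ ε) : Function.Injective (push r n u u') := by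
  intro z z' hz
  by_contra hne
  have hpos : 0 < ‖z - z'‖ := norm_pos_iff.2 (sub_ne_zero.2 hne)
  have h1 : z - z' = ∑ i ∈ Finset.range n,
      ((max 0 (1 - ‖z' - u i‖ / r) - max 0 (1 - ‖z - u i‖ / r) : ℝ) : ℂ) * (u' i - u i) := by
    simp only [push] at hz
    simp only [Complex.ofReal_sub, sub_mul, Finset.sum_sub_distrib]
    linear_combination hz
  have h2 : ‖z - z'‖ ≤ n * (‖z - z'‖ / r * ε) := by
    conv_lhs => rw [h1]
    refine (norm_sum_le_of_le (n := fun _ => ‖z - z'‖ / r * ε) _ fun i hi => ?_).trans ?_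
    · rw [norm_mul, Complex.norm_real, Real.norm_eq_abs]
      refine mul_le_mul ?_ (hu i (Finset.mem_range.1 hi)) (norm_nonneg _) (by positivity)
      rw [max_comm 0, max_comm 0]
      refine (abs_max_sub_max_le_abs _ _ _).trans ?_
      · have : (1 - ‖z' - u i‖ / r) - (1 - ‖z - u i‖ / r) = (‖z - u i‖ - ‖z' - u i‖) / r := by ring
        rw [this, abs_div, abs_of_pos hr]
        gcongr
        simpa using abs_norm_sub_norm_le (z - u i) (z' - u i)
    · simp
  have h3 : n * (‖z - z'‖ / r * ε) = ‖z - z'‖ * (n * ε / r) := by ring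
  have h4 : n * ε / r < 1 := (div_lt_one hr).2 hε
  nlinarith

theorem push_ne {r ε : ℝ} (hr : 0 < r) {n : ℕ} (hε : n * ε < r) {u u' : ℕ → ℂ}
    (hs : ∀ i < n, ∀ j < n, i ≠ j → r ≤ ‖u i - u j‖) (hu : ∀ i < n, ‖u' i - u i‖ ≤ ε) {z : ℂ}
    (hz : ∀ i < n, z ≠ u i) : ∀ i < n, push r n u u' z ≠ u' i := by
  intro i hi h
  rw [← push_apply_point hr hs hi (u' := u')] at h
  exact hz i hi (push_injective hr hε hu h)

theorem continuous_push {X : Type*} [TopologicalSpace X] (r : ℝ) (n : ℕ) {u u' : ℕ → X → ℂ}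
    {w : X → ℂ} (hu : ∀ i < n, Continuous (u i)) (hu' : ∀ i < n, Continuous (u' i))
    (hw : Continuous w) :
    Continuous fun x => push r n (fun i => u i x) (fun i => u' i x) (w x) := by
  unfold push
  refine hw.add (continuous_finsetSum _ fun i hi => ?_)
  have h1 := hu i (Finset.mem_range.1 hi)
  have h2 := hu' i (Finset.mem_range.1 hi)
  fun_prop

/-- A family of `n` distinct moving points is uniformly separated on a compact set. -/
theorem exists_separation {Y : Type*} [TopologicalSpace Y] {S : Set Y} (hS : IsCompact S) {n : ℕ}
    {K : ℕ → Y → ℂ} (hK : ∀ i < n, Continuous (K i))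
    (hne : ∀ i < n, ∀ j < n, i ≠ j → ∀ y, K i y ≠ K j y) :
    ∃ r > 0, ∀ i < n, ∀ j < n, i ≠ j → ∀ y ∈ S, r ≤ ‖K i y - K j y‖ := by
  -- Working with all sufficiently small `r` lets the finitely many pairs be treated separately.
  have h : ∀ᶠ r : ℝ in 𝓝[>] 0, ∀ i ∈ Iio n, ∀ j ∈ Iio n, i ≠ j → ∀ y ∈ S,
      r ≤ ‖K i y - K j y‖ := by
    rw [eventually_all_finite (finite_Iio n)]
    intro i hi
    rw [eventually_all_finite (finite_Iio n)]
    intro j hj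
    by_cases hij : i = j
    · simp [hij]
    obtain ⟨a, ha, hle⟩ := hS.exists_forall_le' (f := fun y => ‖K i y - K j y‖) (a := 0)
      ((hK i hi).sub (hK j hj)).norm.continuousOn
      fun y _ => norm_pos_iff.2 (sub_ne_zero.2 (hne i hi j hj hij y))
    filter_upwards [Ioo_mem_nhdsGT ha] with r hr _ y hy using hr.2.le.trans (hle y hy)
  obtain ⟨r, h, hr⟩ := (h.and self_mem_nhdsWithin).exists
  exact ⟨r, hr, h⟩

/-- Finitely many homotopies on a compact space are equicontinuous in the time parameter. -/
theorem exists_small_step {X : Type*} [PseudoMetricSpace X] [CompactSpace X] {n : ℕ}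
    {K : ℕ → X × ℝ → ℂ} (hK : ∀ i < n, Continuous (K i)) {ε : ℝ} (hε : 0 < ε) :
    ∃ δ > 0, ∀ i < n, ∀ x, ∀ s ∈ Icc (0 : ℝ) 1, ∀ t ∈ Icc (0 : ℝ) 1, |t - s| < δ →
      ‖K i (x, t) - K i (x, s)‖ ≤ ε := by
  have h : ∀ᶠ δ : ℝ in 𝓝[>] 0, ∀ i ∈ Iio n, ∀ x, ∀ s ∈ Icc (0 : ℝ) 1, ∀ t ∈ Icc (0 : ℝ) 1,
      |t - s| < δ → ‖K i (x, t) - K i (x, s)‖ ≤ ε := by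
    rw [eventually_all_finite (finite_Iio n)]
    intro i hi
    have hc : IsCompact ((univ : Set X) ×ˢ Icc (0 : ℝ) 1) := isCompact_univ.prod isCompact_Icc
    obtain ⟨δ, hδ, h⟩ := Metric.uniformContinuousOn_iff.1
      (hc.uniformContinuousOn_of_continuous (hK i hi).continuousOn) ε hε
    filter_upwards [Ioo_mem_nhdsGT hδ] with δ' hδ' x s hs t ht hst
    rw [← dist_eq_norm]
    refine (h (x, t) ⟨mem_univ _, ht⟩ (x, s) ⟨mem_univ _, hs⟩ ?_).le
    rw [Prod.dist_eq, dist_self, Real.dist_eq, max_eq_right (abs_nonneg _)]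
    exact hst.trans hδ'.2
  obtain ⟨δ, h, hδ⟩ := (h.and self_mem_nhdsWithin).exists
  exact ⟨δ, hδ, h⟩

/-- Regular homotopy lifting for the projection forgetting the last point of a configuration: a point
avoiding `n` moving points can be carried along, without being moved where these are at rest. -/
theorem exists_transport {X : Type*} [PseudoMetricSpace X] [CompactSpace X] {n : ℕ}
    {K : ℕ → X × ℝ → ℂ} (hK : ∀ i < n, Continuous (K i))
    (hne : ∀ i < n, ∀ j < n, i ≠ j → ∀ y, K i y ≠ K j y)
    {w : X → ℂ} (hw : Continuous w) (hwne : ∀ i < n, ∀ x, w x ≠ K i (x, 0)) :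
    ∃ w' : X → ℂ, Continuous w' ∧ (∀ i < n, ∀ x, w' x ≠ K i (x, 1)) ∧
      ∀ x, (∀ i < n, ∀ t ∈ Icc (0 : ℝ) 1, K i (x, t) = K i (x, 0)) → w' x = w x := by
  obtain ⟨r, hr, hsep⟩ := exists_separation
    ((isCompact_univ (X := X)).prod (isCompact_Icc (a := (0 : ℝ)) (b := 1))) hK hne
  -- The bound `r / (n + 1)` makes `n * ε < r`, as injectivity of `push` requires.
  obtain ⟨δ, hδ, hstep⟩ := exists_small_step hK (ε := r / (n + 1)) (by positivity)
  have hε : n * (r / (n + 1)) < r := by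
    rw [← mul_div_assoc, div_lt_iff₀ (by positivity)]
    nlinarith
  obtain ⟨N, hN⟩ := exists_nat_one_div_lt hδ
  have hN0 : (0 : ℝ) < N + 1 := by positivity
  have key : ∀ m : ℕ, m ≤ N + 1 → ∃ w' : X → ℂ, Continuous w' ∧
      (∀ i < n, ∀ x, w' x ≠ K i (x, m / (N + 1))) ∧
      ∀ x, (∀ i < n, ∀ t ∈ Icc (0 : ℝ) 1, K i (x, t) = K i (x, 0)) → w' x = w x := by
    intro m
    induction m with
    | zero => exact fun _ => ⟨w, hw, by simpa using hwne, fun _ _ => rfl⟩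
    | succ m ih =>
      intro hm
      obtain ⟨v, hv, hvne, hvst⟩ := ih (by omega)
      have hmem : ∀ k : ℕ, k ≤ N + 1 → (k : ℝ) / (N + 1) ∈ Icc (0 : ℝ) 1 := fun k hk =>
        ⟨by positivity, (div_le_one hN0).2 (by exact_mod_cast hk)⟩
      -- One `push` per time step of length `1 / (N + 1) < δ`; it is the identity where the points
      -- rest.
      refine ⟨fun x => push r n (fun i => K i (x, m / (N + 1)))
        (fun i => K i (x, (m + 1 : ℕ) / (N + 1))) (v x), ?_, ?_, ?_⟩
      · refine continuous_push r n (fun i hi => ?_) (fun i hi => ?_) hv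
        · exact (hK i hi).comp (by fun_prop)
        · exact (hK i hi).comp (by fun_prop)
      · intro i hi x
        refine push_ne hr hε (fun i hi j hj hij => hsep i hi j hj hij _
          ⟨mem_univ _, hmem m (by omega)⟩) (fun i hi => ?_) (fun i hi => hvne i hi x) i hi
        refine hstep i hi x _ (hmem m (by omega)) _ (hmem (m + 1) hm) ?_
        rw [← sub_div, Nat.cast_succ, add_sub_cancel_left, abs_of_pos (by positivity)]
        exact hN
      · intro x hx
        rw [← hvst x hx]
        exact push_of_eq (fun i hi => by
          rw [hx i hi _ (hmem (m + 1) hm), hx i hi _ (hmem m (by omega))]) _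
  obtain ⟨w', h1, h2, h3⟩ := key (N + 1) le_rfl
  refine ⟨w', h1, fun i hi x => ?_, h3⟩
  have := h2 i hi x
  rwa [Nat.cast_succ, div_self hN0.ne'] at this

/-! ### Null-homotopies of finitely many strands. -/

/-- In coordinates: `P` is a null-homotopy of the first `n` strands of the loop `ℓ` of
configurations based at `(0, 1, 2, …)`. -/
structure IsNullHomotopy (ℓ : ℕ → unitInterval → ℂ) (n : ℕ)
    (P : ℕ → unitInterval × unitInterval → ℂ) : Prop where
  continuous : ∀ i < n, Continuous (P i)
  ne : ∀ i < n, ∀ j < n, i ≠ j → ∀ x, P i x ≠ P j x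
  bottom : ∀ i < n, ∀ t, P i (0, t) = ℓ i t
  top : ∀ i < n, ∀ t, P i (1, t) = i
  left : ∀ i < n, ∀ s, P i (s, 0) = i
  right : ∀ i < n, ∀ s, P i (s, 1) = i

/-- A new point away from `n` given ones; it is `n` if these are `0, …, n - 1`. -/
noncomputable def farPoint (n : ℕ) (z : ℕ → ℂ) : ℂ :=
  ((n + ∑ i ∈ Finset.range n, ‖z i - i‖ : ℝ) : ℂ)

/-- The far point has larger modulus than every `z i`, since `‖z i‖ ≤ i + ‖z i - i‖` and `i < n`. -/
theorem farPoint_ne {n i : ℕ} (hi : i < n) (z : ℕ → ℂ) : farPoint n z ≠ z i := by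
  intro h
  have h1 : ‖z i - i‖ ≤ ∑ i ∈ Finset.range n, ‖z i - i‖ :=
    Finset.single_le_sum (f := fun i : ℕ => ‖z i - i‖) (fun _ _ => norm_nonneg _)
      (Finset.mem_range.2 hi)
  have h2 : ‖farPoint n z‖ = n + ∑ i ∈ Finset.range n, ‖z i - i‖ := by
    rw [farPoint, Complex.norm_real, Real.norm_eq_abs, abs_of_nonneg (by positivity)]
  have h3 : ‖z i‖ ≤ ‖z i - i‖ + i := by
    simpa using norm_add_le (z i - i) i
  have h4 : (i : ℝ) < n := by exact_mod_cast hi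
  rw [h] at h2
  linarith

theorem farPoint_eq {n : ℕ} {z : ℕ → ℂ} (h : ∀ i < n, z i = i) : farPoint n z = n := by
  rw [farPoint, Finset.sum_eq_zero, add_zero, Complex.ofReal_natCast]
  intro i hi
  rw [h i (Finset.mem_range.1 hi), sub_self, norm_zero]

theorem continuous_farPoint {X : Type*} [TopologicalSpace X] {n : ℕ} {u : ℕ → X → ℂ}
    (hu : ∀ i < n, Continuous (u i)) : Continuous fun x => farPoint n fun i => u i x := by
  unfold farPoint
  refine Complex.continuous_ofReal.comp (continuous_const.add (continuous_finsetSum _ fun i hi => ?_))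
  exact ((hu i (Finset.mem_range.1 hi)).sub continuous_const).norm

/-- The retraction of the line onto the unit interval. -/
noncomputable def toUnit (r : ℝ) : unitInterval := projIcc 0 1 zero_le_one r

@[fun_prop]
theorem continuous_toUnit : Continuous toUnit :=
  continuous_projIcc (h := zero_le_one)

theorem toUnit_of_nonpos {r : ℝ} (h : r ≤ 0) : toUnit r = 0 := projIcc_of_le_left _ h

theorem toUnit_of_one_le {r : ℝ} (h : 1 ≤ r) : toUnit r = 1 := projIcc_of_right_le _ h

theorem toUnit_coe (s : unitInterval) : toUnit s = s := projIcc_val _ s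

/-! ### Extending a null-homotopy by one strand. -/

variable {ℓ : ℕ → unitInterval → ℂ} {n : ℕ} {H P : ℕ → unitInterval × unitInterval → ℂ}

/-- At time `0`, the concatenation of `P`, its reverse and `H`; the part made of `P` and its reverse
shrinks until at time `1` only `H` is left. -/
noncomputable def cancelHomotopy (P H : ℕ → unitInterval × unitInterval → ℂ) (i : ℕ)
    (y : (unitInterval × unitInterval) × ℝ) : ℂ :=
  if 3 * (y.1.1 : ℝ) ≤ 2 then
    P i (toUnit (min (min (3 * (y.1.1 : ℝ)) (2 - 3 * (y.1.1 : ℝ))) (1 - y.2)), y.1.2)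
  else H i (toUnit (3 * (y.1.1 : ℝ) - 2), y.1.2)

theorem continuous_cancelHomotopy (hP : IsNullHomotopy ℓ n P) (hH : IsNullHomotopy ℓ n H) {i : ℕ}
    (hi : i < n) : Continuous (cancelHomotopy P H i) := by
  have h1 := hP.continuous i hi
  have h2 := hH.continuous i hi
  unfold cancelHomotopy
  -- At the seam `3 * s = 2` both pieces are at their bottom, the loop `ℓ`.
  refine Continuous.if_le (by fun_prop) (by fun_prop) (by fun_prop) (by fun_prop) fun y hy => ?_
  rw [toUnit_of_nonpos (by simp [hy]), toUnit_of_nonpos (by simp [hy]), hP.bottom i hi,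
    hH.bottom i hi]

theorem cancelHomotopy_ne (hP : IsNullHomotopy ℓ n P) (hH : IsNullHomotopy ℓ n H) :
    ∀ i < n, ∀ j < n, i ≠ j → ∀ y, cancelHomotopy P H i y ≠ cancelHomotopy P H j y := by
  intro i hi j hj hij y
  unfold cancelHomotopy
  split_ifs
  · exact hP.ne i hi j hj hij _
  · exact hH.ne i hi j hj hij _

theorem cancelHomotopy_one (hP : IsNullHomotopy ℓ n P) (hH : IsNullHomotopy ℓ n H) {i : ℕ}
    (hi : i < n) (s t : unitInterval) :
    cancelHomotopy P H i ((s, t), 1) = H i (toUnit (3 * (s : ℝ) - 2), t) := by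
  unfold cancelHomotopy
  split_ifs with h
  · rw [toUnit_of_nonpos (by simp), toUnit_of_nonpos (by simpa using h), hP.bottom i hi,
      hH.bottom i hi]
  · rfl

theorem cancelHomotopy_bottom (hP : IsNullHomotopy ℓ n P) {i : ℕ} (hi : i < n)
    (t : unitInterval) (τ : ℝ) : cancelHomotopy P H i ((0, t), τ) = ℓ i t := by
  unfold cancelHomotopy
  rw [if_pos (by simp), toUnit_of_nonpos (by simp), hP.bottom i hi]

theorem cancelHomotopy_top (hH : IsNullHomotopy ℓ n H) {i : ℕ} (hi : i < n)
    (t : unitInterval) (τ : ℝ) : cancelHomotopy P H i ((1, t), τ) = i := by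
  unfold cancelHomotopy
  rw [if_neg (by norm_num), toUnit_of_one_le (by norm_num), hH.top i hi]

theorem cancelHomotopy_left (hP : IsNullHomotopy ℓ n P) (hH : IsNullHomotopy ℓ n H) {i : ℕ}
    (hi : i < n) (s : unitInterval) (τ : ℝ) : cancelHomotopy P H i ((s, 0), τ) = i := by
  unfold cancelHomotopy
  split_ifs
  · exact hP.left i hi _
  · exact hH.left i hi _

theorem cancelHomotopy_right (hP : IsNullHomotopy ℓ n P) (hH : IsNullHomotopy ℓ n H) {i : ℕ}
    (hi : i < n) (s : unitInterval) (τ : ℝ) : cancelHomotopy P H i ((s, 1), τ) = i := by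
  unfold cancelHomotopy
  split_ifs
  · exact hP.right i hi _
  · exact hH.right i hi _

theorem cancelHomotopy_zero_of_le {i : ℕ} {s : unitInterval} (hs : 3 * (s : ℝ) ≤ 1)
    (t : unitInterval) :
    cancelHomotopy P H i ((s, t), 0) = P i (toUnit (3 * (s : ℝ)), t) := by
  unfold cancelHomotopy
  rw [if_pos (by dsimp only; linarith), min_eq_left (a := 3 * (s : ℝ)) (by linarith), sub_zero,
    min_eq_left hs]

/-- A last strand over `cancelHomotopy P H` at time `0`. -/
noncomputable def cancelStrand (n : ℕ) (P H : ℕ → unitInterval × unitInterval → ℂ)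
    (x : unitInterval × unitInterval) : ℂ :=
  if 3 * (x.1 : ℝ) ≤ 1 then P n (toUnit (3 * (x.1 : ℝ)), x.2)
  else farPoint n fun i => cancelHomotopy P H i (x, 0)

theorem IsNullHomotopy.mono {m : ℕ} (hP : IsNullHomotopy ℓ n P) (h : m ≤ n) :
    IsNullHomotopy ℓ m P where
  continuous i hi := hP.continuous i (hi.trans_le h)
  ne i hi j hj := hP.ne i (hi.trans_le h) j (hj.trans_le h)
  bottom i hi := hP.bottom i (hi.trans_le h)
  top i hi := hP.top i (hi.trans_le h)
  left i hi := hP.left i (hi.trans_le h)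
  right i hi := hP.right i (hi.trans_le h)

theorem continuous_cancelStrand (hP : IsNullHomotopy ℓ (n + 1) P) (hH : IsNullHomotopy ℓ n H) :
    Continuous (cancelStrand n P H) := by
  have hP' := hP.mono n.le_succ
  have h1 := hP.continuous n n.lt_succ_self
  have h2 : Continuous fun x => farPoint n fun i => cancelHomotopy P H i (x, 0) :=
    continuous_farPoint fun i hi => (continuous_cancelHomotopy hP' hH hi).comp (by fun_prop)
  unfold cancelStrand
  -- At the seam `3 * s = 1`, `P` has reached its top, where the far point is `n`.
  refine Continuous.if_le (by fun_prop) h2 (by fun_prop) (by fun_prop) fun x hx => ?_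
  rw [toUnit_of_one_le hx.ge, hP.top n n.lt_succ_self, farPoint_eq]
  intro i hi
  rw [cancelHomotopy_zero_of_le hx.le, toUnit_of_one_le hx.ge, hP'.top i hi]

theorem cancelStrand_ne (hP : IsNullHomotopy ℓ (n + 1) P) :
    ∀ i < n, ∀ x, cancelStrand n P H x ≠ cancelHomotopy P H i (x, 0) := by
  rintro i hi ⟨s, t⟩
  unfold cancelStrand
  split_ifs with h
  · rw [cancelHomotopy_zero_of_le h]
    exact hP.ne n n.lt_succ_self i (hi.trans n.lt_succ_self) hi.ne' _
  · exact farPoint_ne hi _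

/-- Every null-homotopy of the first `n` strands extends to one of the first `n + 1` strands, if
there is any null-homotopy of these. -/
theorem IsNullHomotopy.exists_extension (hP : IsNullHomotopy ℓ (n + 1) P)
    (hH : IsNullHomotopy ℓ n H) :
    ∃ v, IsNullHomotopy ℓ (n + 1) (Function.update H n v) := by
  have hP' := hP.mono n.le_succ
  have hn := n.lt_succ_self
  obtain ⟨w, hw, hwne, hwst⟩ := exists_transport
    (fun i hi => continuous_cancelHomotopy hP' hH hi) (cancelHomotopy_ne hP' hH)
    (continuous_cancelStrand hP hH) (cancelStrand_ne hP)
  -- The first transport ends over `H` run at parameter `3 * s - 2`; the second slides this linearly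
  -- to `s`.
  obtain ⟨v, hv, hvne, hvst⟩ := exists_transport (n := n) (w := w)
    (K := fun i y => H i (toUnit ((1 - y.2) * (3 * (y.1.1 : ℝ) - 2) + y.2 * y.1.1), y.1.2))
    (fun i hi => (hH.continuous i hi).comp (by fun_prop))
    (fun i hi j hj hij y => hH.ne i hi j hj hij _) hw
    (by
      rintro i hi ⟨s, t⟩
      simpa [cancelHomotopy_one hP' hH hi] using hwne i hi (s, t))
  have hbot : ∀ t, v (0, t) = ℓ n t := by
    intro t
    rw [hvst, hwst, cancelStrand, if_pos (by simp), toUnit_of_nonpos (by simp), hP.bottom n hn]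
    · intro i hi τ _
      rw [cancelHomotopy_bottom hP' hi, cancelHomotopy_bottom hP' hi]
    · intro i hi τ hτ
      dsimp only
      -- At `s = 0` the parameter is `-2 * (1 - τ) ≤ 0`, so clamping keeps the strands at rest.
      rw [toUnit_of_nonpos, toUnit_of_nonpos] <;> norm_num
      linarith [hτ.2]
  have htop : ∀ t, v (1, t) = n := by
    intro t
    rw [hvst, hwst, cancelStrand, if_neg (by norm_num), farPoint_eq]
    · exact fun i hi => cancelHomotopy_top hH hi _ _
    · intro i hi τ _
      rw [cancelHomotopy_top hH hi, cancelHomotopy_top hH hi]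
    · intro i hi τ hτ
      dsimp only
      rw [toUnit_of_one_le, toUnit_of_one_le] <;> norm_num
  have hleft : ∀ s, v (s, 0) = n := by
    intro s
    rw [hvst, hwst, cancelStrand]
    · split_ifs
      · exact hP.left n hn _
      · exact farPoint_eq fun i hi => cancelHomotopy_left hP' hH hi _ _
    · intro i hi τ _
      rw [cancelHomotopy_left hP' hH hi, cancelHomotopy_left hP' hH hi]
    · intro i hi τ _
      rw [hH.left i hi, hH.left i hi]
  have hright : ∀ s, v (s, 1) = n := by
    intro s
    rw [hvst, hwst, cancelStrand]
    · split_ifs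
      · exact hP.right n hn _
      · exact farPoint_eq fun i hi => cancelHomotopy_right hP' hH hi _ _
    · intro i hi τ _
      rw [cancelHomotopy_right hP' hH hi, cancelHomotopy_right hP' hH hi]
    · intro i hi τ _
      rw [hH.right i hi, hH.right i hi]
  have hne : ∀ i < n, ∀ x, v x ≠ H i x := by
    rintro i hi ⟨s, t⟩
    simpa [toUnit_coe] using hvne i hi (s, t)
  have hcases : ∀ i < n + 1, i = n ∧ Function.update H n v i = v ∨
      i < n ∧ Function.update H n v i = H i := by
    intro i hi
    rcases Nat.lt_succ_iff_lt_or_eq.1 hi with h | rfl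
    · exact Or.inr ⟨h, Function.update_of_ne h.ne _ _⟩
    · exact Or.inl ⟨rfl, Function.update_self ..⟩
  refine ⟨v, fun i hi => ?_, fun i hi j hj hij x => ?_, fun i hi t => ?_, fun i hi t => ?_,
    fun i hi s => ?_, fun i hi s => ?_⟩
  · rcases hcases i hi with ⟨rfl, h⟩ | ⟨hi, h⟩ <;> rw [h]
    exacts [hv, hH.continuous i hi]
  · rcases hcases i hi with ⟨rfl, h⟩ | ⟨hi, h⟩ <;> rcases hcases j hj with ⟨rfl, h'⟩ | ⟨hj, h'⟩ <;>
      first | exact absurd rfl hij | rw [h, h']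
    exacts [hne j hj x, (hne i hi x).symm, hH.ne i hi j hj hij x]
  · rcases hcases i hi with ⟨rfl, h⟩ | ⟨hi, h⟩ <;> rw [h]
    exacts [hbot t, hH.bottom i hi t]
  · rcases hcases i hi with ⟨rfl, h⟩ | ⟨hi, h⟩ <;> rw [h]
    exacts [htop t, hH.top i hi t]
  · rcases hcases i hi with ⟨rfl, h⟩ | ⟨hi, h⟩ <;> rw [h]
    exacts [hleft s, hH.left i hi s]
  · rcases hcases i hi with ⟨rfl, h⟩ | ⟨hi, h⟩ <;> rw [h]
    exacts [hright s, hH.right i hi s]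

/-! ### Passage to infinitely many strands. -/

theorem IsNullHomotopy.congr {Q : ℕ → unitInterval × unitInterval → ℂ}
    (hP : IsNullHomotopy ℓ n P) (h : ∀ i < n, P i = Q i) : IsNullHomotopy ℓ n Q where
  continuous i hi := h i hi ▸ hP.continuous i hi
  ne i hi j hj := h i hi ▸ h j hj ▸ hP.ne i hi j hj
  bottom i hi := h i hi ▸ hP.bottom i hi
  top i hi := h i hi ▸ hP.top i hi
  left i hi := h i hi ▸ hP.left i hi
  right i hi := h i hi ▸ hP.right i hi

/-- If any finite number of strands can be contracted, then all strands can simultaneously. -/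
theorem exists_isNullHomotopy_forall (h : ∀ n, ∃ P, IsNullHomotopy ℓ n P) :
    ∃ W, ∀ n, IsNullHomotopy ℓ n W := by
  have hstep : ∀ n H, ∃ v, IsNullHomotopy ℓ n H →
      IsNullHomotopy ℓ (n + 1) (Function.update H n v) := by
    intro n H
    by_cases hH : IsNullHomotopy ℓ n H
    · obtain ⟨P, hP⟩ := h (n + 1)
      obtain ⟨v, hv⟩ := hP.exists_extension hH
      exact ⟨v, fun _ => hv⟩
    -- A junk value makes the choice of `v` total, so that the recursion needs no proofs.
    · exact ⟨0, fun h => absurd h hH⟩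
  choose v hv using hstep
  let A : ℕ → ℕ → unitInterval × unitInterval → ℂ :=
    fun n => Nat.rec (fun _ => 0) (fun n H => Function.update H n (v n H)) n
  have hA : ∀ n, IsNullHomotopy ℓ n (A n) := by
    intro n
    induction n with
    | zero => constructor <;> simp
    | succ n ih => exact hv n _ ih
  have hstable : ∀ i n, i < n → A n i = A (i + 1) i := by
    intro i n hin
    induction n, Nat.succ_le_of_lt hin using Nat.le_induction with
    | base => rfl
    | succ n hn ih =>
      exact (Function.update_of_ne (Nat.ne_of_lt hn) _ _).trans (ih hn)
  -- Strand `i` is created at stage `i + 1` and never altered later.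
  exact ⟨fun i => A (i + 1) i, fun n => (hA n).congr fun i hi => hstable i n hi⟩

/-! ### From coordinates back to paths of configurations. -/

theorem homotopic_trans_symm_iff {Z : Type*} [TopologicalSpace Z] {a b : Z} {p q : Path a b} :
    (p.trans q.symm).Homotopic (Path.refl a) ↔ p.Homotopic q := by
  constructor
  · intro h
    have h1 : p.Homotopic (p.trans (Path.refl b)) := ⟨(Path.Homotopy.transRefl p).symm⟩
    have h2 : (p.trans (Path.refl b)).Homotopic (p.trans (q.symm.trans q)) :=
      (Path.Homotopic.refl p).hcomp ⟨Path.Homotopy.reflSymmTrans q⟩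
    have h3 : (p.trans (q.symm.trans q)).Homotopic ((p.trans q.symm).trans q) :=
      ⟨(Path.Homotopy.transAssoc p q.symm q).symm⟩
    have h4 : ((p.trans q.symm).trans q).Homotopic ((Path.refl a).trans q) :=
      h.hcomp (Path.Homotopic.refl q)
    exact (((h1.trans h2).trans h3).trans h4).trans ⟨Path.Homotopy.reflTrans q⟩
  · intro h
    exact (h.hcomp (Path.Homotopic.refl q.symm)).trans ⟨(Path.Homotopy.reflTransSymm q).symm⟩

/-- The natural number `k` as a point of `omega`. -/
def omegaPoint (k : ℕ) : omega := ⟨k, k, rfl⟩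

/-- The natural number `k < n` as a point of `initial n`. -/
def initialPoint {n k : ℕ} (h : k < n) : initial n := ⟨k, k, h, rfl⟩

theorem Conf.injective {X : Set ℂ} (u : Conf X) : Function.Injective u.1 :=
  mem_compl_diagonal_iff.1 u.2

theorem Conf.continuous_coord {X : Set ℂ} (x : X) : Continuous fun u : Conf X => u.1 x :=
  (continuous_apply (A := fun _ : X => ℂ) x).comp continuous_subtype_val

theorem Conf.ext_omega {u v : Conf omega} (h : ∀ k, u.1 (omegaPoint k) = v.1 (omegaPoint k)) :
    u = v := by
  refine Subtype.ext (funext ?_)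
  rintro ⟨_, k, rfl⟩
  exact h k

theorem exists_isNullHomotopy {a : Conf omega} (ha : ∀ k, a.1 (omegaPoint k) = k) {ℓ : Path a a}
    {n : ℕ} (h : (ℓ.map (Conf.restrict (initial_subset_omega n)).continuous).Homotopic
      (Path.refl _)) :
    ∃ P, IsNullHomotopy (fun k t => (ℓ t).1 (omegaPoint k)) n P := by
  obtain ⟨F⟩ := h
  refine ⟨fun k x => if hk : k < n then (F x).1 (initialPoint hk) else 0,
    fun i hi => ?_, fun i hi j hj hij x => ?_, fun i hi t => ?_, fun i hi t => ?_,
    fun i hi s => ?_, fun i hi s => ?_⟩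
  · simp only [dif_pos hi]
    exact (Conf.continuous_coord _).comp F.continuous
  · simp only [dif_pos hi, dif_pos hj]
    exact fun h => hij (Nat.cast_injective (R := ℂ)
      (congrArg Subtype.val ((F x).injective h)))
  · simp only [dif_pos hi]
    rw [F.apply_zero]
    rfl
  · simp only [dif_pos hi]
    rw [F.apply_one]
    exact ha i
  · simp only [dif_pos hi]
    rw [Path.Homotopy.source]
    exact ha i
  · simp only [dif_pos hi]
    rw [Path.Homotopy.target]
    exact ha i

theorem homotopic_refl_of_isNullHomotopy {a : Conf omega} (ha : ∀ k, a.1 (omegaPoint k) = k)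
    {ℓ : Path a a} {W : ℕ → unitInterval × unitInterval → ℂ}
    (hW : ∀ n, IsNullHomotopy (fun k t => (ℓ t).1 (omegaPoint k)) n W) :
    ℓ.Homotopic (Path.refl a) := by
  choose e he using fun x : omega => x.2
  have he' : ∀ k, e (omegaPoint k) = k := fun k => Nat.cast_injective (R := ℂ) (he (omegaPoint k))
  have he_inj : Function.Injective e := fun x y h =>
    Subtype.ext ((he x).symm.trans ((congrArg (fun k : ℕ => (k : ℂ)) h).trans (he y)))
  have hne : ∀ i j, i ≠ j → ∀ x, W i x ≠ W j x := fun i j =>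
    (hW (max i j + 1)).ne i (by omega) j (by omega)
  let F : unitInterval × unitInterval → Conf omega := fun x =>
    ⟨fun y => W (e y) x, mem_compl_diagonal_iff.2 fun y y' h =>
      he_inj (by_contra fun hyy => hne _ _ hyy x h)⟩
  have hF : ∀ k x, (F x).1 (omegaPoint k) = W k x := fun k x => by
    change W (e (omegaPoint k)) x = W k x
    rw [he']
  have hFc : Continuous F := Continuous.subtype_mk
    (continuous_pi fun y => (hW (e y + 1)).continuous _ (Nat.lt_succ_self _)) _
  refine ⟨⟨⟨⟨F, hFc⟩, fun t => ?_, fun t => ?_⟩, fun s t ht => ?_⟩⟩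
  · exact Conf.ext_omega fun k => (hF k _).trans ((hW (k + 1)).bottom k k.lt_succ_self t)
  · exact Conf.ext_omega fun k => (hF k _).trans
      (((hW (k + 1)).top k k.lt_succ_self t).trans (ha k).symm)
  · rcases ht with rfl | rfl
    · exact Conf.ext_omega fun k => (hF k _).trans
        (((hW (k + 1)).left k k.lt_succ_self s).trans (by simp [ha]))
    · exact Conf.ext_omega fun k => (hF k _).trans
        (((hW (k + 1)).right k k.lt_succ_self s).trans (by simp [ha]))

theorem path_homotopic_of_restrict {a b : Conf omega} (ha : ∀ k, a.1 (omegaPoint k) = k)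
    {p q : Path a b}
    (h : ∀ n, (p.map (Conf.restrict (initial_subset_omega n)).continuous).Homotopic
      (q.map (Conf.restrict (initial_subset_omega n)).continuous)) : p.Homotopic q := by
  rw [← homotopic_trans_symm_iff]
  obtain ⟨W, hW⟩ := exists_isNullHomotopy_forall
    (ℓ := fun k t => ((p.trans q.symm) t).1 (omegaPoint k)) fun n => by
      refine exists_isNullHomotopy ha ?_
      rw [Path.map_trans, ← Path.map_symm]
      exact homotopic_trans_symm_iff.2 (h n)
  exact homotopic_refl_of_isNullHomotopy ha hW

end InfBraid

theorem theorem2p4 (f g : C(unitInterval, InfBraid.Conf InfBraid.omega))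
    (hf : InfBraid.IsBraid f) (hg : InfBraid.IsBraid g) :
    InfBraid.PathHomotopic f g ↔
      ∀ n : ℕ, InfBraid.PathHomotopic
        (InfBraid.restrictPath (InfBraid.initial_subset_omega n) f)
        (InfBraid.restrictPath (InfBraid.initial_subset_omega n) g) := by
  refine ⟨fun h n => h.comp_continuousMap _, fun h => ?_⟩
  have h0 : g 0 = f 0 := InfBraid.Conf.ext_omega fun k => (hg.source _).trans (hf.source _).symm
  have h1 : g 1 = f 1 := InfBraid.Conf.ext_omega fun k => by
    -- Relative homotopies fix endpoints, and point `k` is visible among the first `k + 1` strands.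
    have := (h (k + 1)).fst_eq_snd (x := 1) (by simp)
    exact (congrArg (fun u => u.1 (InfBraid.initialPoint k.lt_succ_self)) this).symm
  let p : Path (f 0) (f 1) := ⟨f, rfl, rfl⟩
  let q : Path (f 0) (f 1) := ⟨g, h0, h1⟩
  exact InfBraid.path_homotopic_of_restrict (p := p) (q := q) (fun k => hf.source _) h
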